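/- Let $G$ be a finite, connected, simple $4$-regular graph and let $\overrightarrow{G}$ be an orientation of $G$ (each edge of $G$ is replaced by exactly one of its two possible arcs). Then $\mathsf{c_{sp}}(\overrightarrow{G}) = 1$; that is, one cop with the strong push ability has a winning strategy on $\overrightarrow{G}$. Here $\mathsf{c_{sp}}(\overrightarrow{G})$ is the minimum number of cops that have a winning strategy in the following game. First the cops place themselves on vertices of $\overrightarrow{G}$ (several may share a vertex), then the robber chooses a vertex, with all positions visible to both sides. After that the two sides alternate turns, beginning with the cops. In a turn of the cops, each cop either stays on its vertex, or moves to an out-neighbour of its vertex, or pushes an arbitrary vertex $w$ of the graph, which reverses all arcs currently incident to $w$. In its turn, the robber either stays on its vertex or moves to an out-neighbour of its vertex. Out-neighbours are taken in the current orientation. The cops win if, after finitely many turns, some cop is on the vertex of the robber; otherwise the robber wins. -/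

import Mathlib

/-- `D` is an orientation of the simple graph `G`: `D` has no loops and no 2-cycles, and the
underlying undirected graph of `D` is `G`. -/
structure IsOrientation {V : Type*} (D : Digraph V) (G : SimpleGraph V) : Prop where
  asymm : ∀ u v, D.Adj u v → ¬ D.Adj v u
  adj_iff : ∀ u v, G.Adj u v ↔ D.Adj u v ∨ D.Adj v u

/-- The push operation on `v`: every arc incident to `v` is reversed. -/
def pushVertex {V : Type*} (D : Digraph V) (v : V) : Digraph V where
  Adj a b := ((a = v ∨ b = v) ∧ D.Adj b a) ∨ (a ≠ v ∧ b ≠ v ∧ D.Adj a b)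

/-- What a cop with the strong push ability can do in a turn: go to a vertex (its own vertex means
staying), or push a vertex. -/
inductive CopAction (V : Type*) where
  | move (u : V) : CopAction V
  | push (w : V) : CopAction V

/-- An action is legal for a cop on `c` if it goes to a vertex of the closed out-neighbourhood
`N⁺[c]`, or pushes any vertex of the graph whatsoever. -/
def CopAction.Legal {V : Type*} (D : Digraph V) (c : V) : CopAction V → Prop
  | .move u => u = c ∨ D.Adj c u
  | .push _ => True

/-- The vertex on which a cop standing on `c` ends up. -/
def CopAction.dest {V : Type*} (c : V) : CopAction V → V
  | .move u => u
  | .push _ => c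

/-- The effect of an action on the orientation. -/
def CopAction.effect {V : Type*} (D : Digraph V) : CopAction V → Digraph V
  | .move _ => D
  | .push w => pushVertex D w

/-- A position of the game with `k` cops: the current orientation of the graph, the vertices of
the cops, and the vertex of the robber. -/
structure Position (V : Type*) (k : ℕ) where
  graph : Digraph V
  cops : Fin k → V
  robber : V

/-- The robber is captured: some cop is on its vertex. -/
def Position.Captured {V : Type*} {k : ℕ} (p : Position V k) : Prop :=
  ∃ i, p.cops i = p.robber

/-- The position after a turn of the cops in which cop `i` performs the action `a i`; the pushes
of all cops are carried out, one after the other (their order does not matter). -/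
def Position.afterCops {V : Type*} {k : ℕ} (p : Position V k) (a : Fin k → CopAction V) :
    Position V k where
  graph := (List.ofFn a).foldl CopAction.effect p.graph
  cops i := (a i).dest (p.cops i)
  robber := p.robber

/-- A turn of the robber: it stays or moves to an out-neighbour; it cannot push. -/
def RobberTurn {V : Type*} {k : ℕ} (p q : Position V k) : Prop :=
  q.graph = p.graph ∧ q.cops = p.cops ∧
    (q.robber = p.robber ∨ p.graph.Adj p.robber q.robber)

/-- A strategy for `k` cops: the initial placement, and a rule that prescribes a legal action of
every cop, given the list `h` of the positions at the beginning of the earlier rounds and the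
current position `p`. -/
structure CopStrategy (V : Type*) (k : ℕ) where
  start : Fin k → V
  act : List (Position V k) → Position V k → Fin k → CopAction V
  legal : ∀ h p i, (act h p i).Legal p.graph (p.cops i)

/-- `p n` and `q n` are the positions before and after the `n`-th turn of the cops in a play
on `D` in which the cops follow `σ`. The cops place themselves first, then the robber chooses any
vertex, and then the two sides alternate, beginning with the cops. -/
structure IsPlay {V : Type*} {k : ℕ} (D : Digraph V) (σ : CopStrategy V k)
    (p q : ℕ → Position V k) : Prop where
  init_graph : (p 0).graph = D
  init_cops : (p 0).cops = σ.start
  cop_turn : ∀ n, q n = (p n).afterCops (σ.act ((List.range n).map p) (p n))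
  robber_turn : ∀ n, RobberTurn (q n) (p (n + 1))

/-- `k` cops with the strong push ability have a winning strategy on `D`: against every play of the
robber, it is captured after finitely many turns. -/
def StrongPushCopsWin {V : Type*} (D : Digraph V) (k : ℕ) : Prop :=
  ∃ σ : CopStrategy V k, ∀ p q : ℕ → Position V k, IsPlay D σ p q →
    ∃ n, (p n).Captured ∨ (q n).Captured

/-- The strong push cop number `c_sp(D)`: the minimum number of cops with the strong push ability
that have a winning strategy on `D`. For finite `V` the minimum is over a nonempty set,
since a cop on every vertex captures the robber at once. -/
noncomputable def strongPushCopNumber {V : Type*} (D : Digraph V) : ℕ :=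
  sInf {k : ℕ | StrongPushCopsWin D k}

/-!
The robber cannot push, so the cop wins as soon as the robber stands on a sink: the cop walks to
it, pushing its own vertex whenever an arc points the wrong way. Call the robber's vertex `r`
*doomed* if the cop, to move, wins from wherever it stands. In a 4-regular graph `r` is doomed if
its out-degree is zero, one (push the out-neighbour) or four (push `r`). If the out-neighbours are
`x` and `y`, a push of `x` forces the robber to `y`, since staying means out-degree one
(`doomed_of_force`). If the robber comes from a vertex of out-degree at most two to a vertex of
out-degree three, a push of the latter forces it back to a vertex of out-degree at most one
(`doomed_of_adj`). So the robber may only visit vertices of out-degree two, and it is lost if an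
out-neighbour has another out-degree, or if `x` and `y` are adjacent (`doomed_of_irregular`). Apart
from the walk to a sink, adjacent out-neighbours are the only case in which the cop has to approach
the robber (`doomed_of_triangle`).

The cop leads the robber, by such forcing pushes, along a shortest directed walk to a vertex `t`
of out-degree other than two (`walkDooms`, by induction on the length). This fails only if the
push of the other out-neighbour `x` repairs the out-degree of `t`.
* If `t` has out-degree one, then `x → t` and the distance is two; see `doomed_of_diamond`.
* If `t` has out-degree three, then `t → x`. If `t` is not adjacent to `r`, a push of `t` spoils
  the out-degrees of `x` and of the last vertex before `t`. Otherwise `t → r`, and `r`, which has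
  lost an arc by the push of `x`, takes over the role of `t`.

Finally, such a vertex `t` can always be reached. The vertices reachable from the robber, if all of
out-degree two, would have as many incoming as outgoing arcs, hence be closed under adjacency and
exhaust the graph (`outDeg_eq_two_of_reachable`); but after one forcing push the vertex just left
has out-degree one. A robber that starts on a vertex of out-degree three is forced to the only
in-neighbour, and the above applies there (`doomed`).
-/

/-! ### Positions won by the cop -/

/-- The number of out-neighbours of `v` in `D`. -/
noncomputable def outDeg {V : Type*} (D : Digraph V) (v : V) : ℕ :=
  {u | D.Adj v u}.ncard

/-- A single cop on `c`, to move in the orientation `D`, can catch the robber on `r` within `n`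
rounds. A round that ends with the cop on the vertex of the robber is won before the robber can
answer. -/
def CatchableWithin {V : Type*} : ℕ → Digraph V → V → V → Prop
  | 0, _, c, r => c = r
  | n + 1, D, c, r => c = r ∨ ∃ a : CopAction V, a.Legal D c ∧
      (a.dest c = r ∨ ∀ r', r' = r ∨ (a.effect D).Adj r r' →
        CatchableWithin n (a.effect D) (a.dest c) r')

/-- A single cop on `c`, to move in the orientation `D`, can catch the robber on `r`. -/
def Catchable {V : Type*} (D : Digraph V) (c r : V) : Prop :=
  ∃ n, CatchableWithin n D c r

/-- With the cop to move in the orientation `D`, the robber on `r` can be caught from every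
position of the cop. -/
def Doomed {V : Type*} (D : Digraph V) (r : V) : Prop :=
  ∀ c, Catchable D c r

/-! ### From winning positions to a strategy -/

section Game

variable {V : Type*} {D : Digraph V} {c r : V}

theorem CatchableWithin.succ : ∀ {n : ℕ} {D : Digraph V} {c r : V},
    CatchableWithin n D c r → CatchableWithin (n + 1) D c r
  | 0, _, _, _, h => Or.inl h
  | _ + 1, _, _, _, Or.inl h => Or.inl h
  | _ + 1, _, _, _, Or.inr ⟨a, ha, Or.inl h⟩ => Or.inr ⟨a, ha, Or.inl h⟩
  | _ + 1, _, _, _, Or.inr ⟨a, ha, Or.inr h⟩ =>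
      Or.inr ⟨a, ha, Or.inr fun r' hr' => (h r' hr').succ⟩

theorem CatchableWithin.mono {m n : ℕ} (hmn : m ≤ n) (h : CatchableWithin m D c r) :
    CatchableWithin n D c r := by
  induction hmn with
  | refl => exact h
  | step _ ih => exact ih.succ

theorem catchable_self (D : Digraph V) (r : V) : Catchable D r r := ⟨0, rfl⟩

theorem catchable_of_adj (h : D.Adj c r) : Catchable D c r :=
  ⟨1, Or.inr ⟨.move r, Or.inr h, Or.inl rfl⟩⟩

theorem catchable_of_action [Finite V] (a : CopAction V) (ha : a.Legal D c)
    (h : ∀ r', r' = r ∨ (a.effect D).Adj r r' → Catchable (a.effect D) (a.dest c) r') :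
    Catchable D c r := by
  cases nonempty_fintype V
  -- the robber has finitely many answers, so the numbers of remaining rounds are bounded
  have h' : ∀ r', ∃ n, r' = r ∨ (a.effect D).Adj r r' →
      CatchableWithin n (a.effect D) (a.dest c) r' := by
    intro r'
    by_cases hr' : r' = r ∨ (a.effect D).Adj r r'
    · obtain ⟨n, hn⟩ := h r' hr'
      exact ⟨n, fun _ => hn⟩
    · exact ⟨0, fun h => absurd h hr'⟩
  choose f hf using h'
  exact ⟨Finset.univ.sup f + 1, Or.inr ⟨a, ha, Or.inr fun r' hr' =>
    (hf r' hr').mono (Finset.le_sup (Finset.mem_univ r'))⟩⟩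

theorem catchable_of_move [Finite V] {u : V} (hu : D.Adj c u)
    (h : ∀ r', r' = r ∨ D.Adj r r' → Catchable D u r') : Catchable D c r :=
  catchable_of_action (.move u) (Or.inr hu) h

theorem catchable_of_push [Finite V] (w : V)
    (h : ∀ r', r' = r ∨ (pushVertex D w).Adj r r' → Catchable (pushVertex D w) c r') :
    Catchable D c r :=
  catchable_of_action (.push w) trivial h

theorem Doomed.of_push [Finite V] (w : V)
    (h : ∀ r', r' = r ∨ (pushVertex D w).Adj r r' → Doomed (pushVertex D w) r') :
    Doomed D r :=
  fun c => catchable_of_push w fun r' hr' => h r' hr' c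

/-- A single action suits all lengths `n`, because only the least number of rounds `n + 1`
matters; this makes the resulting strategy depend on the position alone. -/
theorem exists_action_decreasing (D : Digraph V) (c r : V) :
    ∃ a : CopAction V, a.Legal D c ∧
      ∀ n, CatchableWithin (n + 1) D c r → ¬ CatchableWithin n D c r →
        a.dest c = r ∨ ∀ r', r' = r ∨ (a.effect D).Adj r r' →
          CatchableWithin n (a.effect D) (a.dest c) r' := by
  by_cases h : ∃ n, CatchableWithin (n + 1) D c r ∧ ¬ CatchableWithin n D c r
  · obtain ⟨n, hn, hn'⟩ := h
    rcases hn with hcr | ⟨a, ha, hgood⟩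
    · exact absurd (CatchableWithin.mono (Nat.zero_le n) hcr) hn'
    · refine ⟨a, ha, fun m hm hm' => ?_⟩
      have hmn : m = n := by
        rcases lt_trichotomy m n with hlt | heq | hlt
        · exact absurd (hm.mono hlt) hn'
        · exact heq
        · exact absurd (CatchableWithin.mono hlt (Or.inr ⟨a, ha, hgood⟩)) hm'
      rw [hmn]
      exact hgood
  · push Not at h
    exact ⟨.move c, Or.inl rfl, fun n hn hn' => absurd (h n hn) hn'⟩

theorem strongPushCopsWin_one_of_catchable (D : Digraph V) (s : V)
    (h : ∀ r, Catchable D s r) : StrongPushCopsWin D 1 := by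
  choose act hlegal hact using exists_action_decreasing (V := V)
  let σ : CopStrategy V 1 :=
    { start := fun _ => s
      act := fun _ p i => act p.graph (p.cops i) p.robber
      legal := fun _ p i => hlegal p.graph (p.cops i) p.robber }
  refine ⟨σ, fun p q hpq => ?_⟩
  have key : ∀ m n, CatchableWithin m (p n).graph ((p n).cops 0) (p n).robber →
      ∃ n, (p n).Captured ∨ (q n).Captured := by
    intro m
    induction m with
    | zero => exact fun n hn => ⟨n, Or.inl ⟨0, hn⟩⟩
    | succ m ih =>
      intro n hn
      by_cases hm : CatchableWithin m (p n).graph ((p n).cops 0) (p n).robber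
      · exact ih n hm
      have hq := hpq.cop_turn n
      rcases hact _ _ _ m hn hm with hdest | hnext
      · refine ⟨n, Or.inr ⟨0, ?_⟩⟩
        rw [hq]
        exact hdest
      · obtain ⟨hg, hc, hr⟩ := hpq.robber_turn n
        refine ih (n + 1) ?_
        rw [hg, hc]
        rw [hq] at hr ⊢
        exact hnext _ hr
  obtain ⟨m, hm⟩ := h (p 0).robber
  refine key m 0 ?_
  rw [hpq.init_graph, hpq.init_cops]
  exact hm

theorem not_strongPushCopsWin_zero [Nonempty V] (D : Digraph V) : ¬ StrongPushCopsWin D 0 := by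
  rintro ⟨σ, hσ⟩
  let p : Position V 0 := ⟨D, σ.start, Classical.arbitrary V⟩
  obtain ⟨n, ⟨i, _⟩ | ⟨i, _⟩⟩ := hσ (fun _ => p) (fun _ => p)
    { init_graph := rfl
      init_cops := rfl
      cop_turn := fun n => by
        simp only [p, Position.afterCops, List.ofFn_zero, List.foldl_nil]
        congr 1
        exact Subsingleton.elim _ _
      robber_turn := fun _ => ⟨rfl, rfl, Or.inl rfl⟩ }
  · exact i.elim0
  · exact i.elim0

end Game

/-! ### Pushes and out-degrees -/

section Push

variable {V : Type*} {G : SimpleGraph V} {D : Digraph V} {v w : V}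

theorem pushVertex_adj_of_ne {a b : V} (ha : a ≠ w) (hb : b ≠ w) :
    (pushVertex D w).Adj a b ↔ D.Adj a b := by
  simp [pushVertex, ha, hb]

theorem pushVertex_adj_left {b : V} : (pushVertex D w).Adj w b ↔ D.Adj b w := by
  simp [pushVertex]

theorem pushVertex_adj_right {a : V} : (pushVertex D w).Adj a w ↔ D.Adj w a := by
  simp [pushVertex]

namespace IsOrientation

theorem push (hD : IsOrientation D G) (w : V) : IsOrientation (pushVertex D w) G where
  asymm a b := by
    have := hD.asymm a b
    have := hD.asymm b a
    simp only [pushVertex]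
    tauto
  adj_iff a b := by
    have := hD.adj_iff a b
    simp only [pushVertex]
    tauto

theorem adj (hD : IsOrientation D G) {a b : V} (h : D.Adj a b) : G.Adj a b :=
  (hD.adj_iff a b).2 (Or.inl h)

theorem ne (hD : IsOrientation D G) {a b : V} (h : D.Adj a b) : a ≠ b :=
  (hD.adj h).ne

theorem outDeg_push_of_not_adj (hD : IsOrientation D G) (hne : v ≠ w) (h : ¬ G.Adj v w) :
    outDeg (pushVertex D w) v = outDeg D v := by
  unfold outDeg
  congr 1
  ext u
  rw [hD.adj_iff] at h
  push Not at h
  by_cases hu : u = w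
  · subst hu
    simp [pushVertex_adj_right, h.1, h.2]
  · simp [pushVertex_adj_of_ne hne hu]

theorem outDeg_push_of_out [Finite V] (hD : IsOrientation D G) (h : D.Adj v w) :
    outDeg (pushVertex D w) v + 1 = outDeg D v := by
  have hset : {u | (pushVertex D w).Adj v u} = {u | D.Adj v u} \ {w} := by
    ext u
    by_cases hu : u = w
    · subst hu
      simp [pushVertex_adj_right, hD.asymm _ _ h]
    · simp [pushVertex_adj_of_ne (hD.ne h) hu, hu]
  unfold outDeg
  rw [hset]
  exact Set.ncard_sdiff_singleton_add_one (s := {u | D.Adj v u}) h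

theorem outDeg_push_of_in [Finite V] (hD : IsOrientation D G) (h : D.Adj w v) :
    outDeg (pushVertex D w) v = outDeg D v + 1 := by
  have hset : {u | (pushVertex D w).Adj v u} = insert w {u | D.Adj v u} := by
    ext u
    by_cases hu : u = w
    · subst hu
      simp [pushVertex_adj_right, h]
    · simp [pushVertex_adj_of_ne (hD.ne h).symm hu, hu]
  unfold outDeg
  rw [hset]
  exact Set.ncard_insert_of_notMem (hD.asymm _ _ h)

end IsOrientation

/-- The arcs leaving and entering a vertex of a 4-regular graph are four in number. -/
theorem IsOrientation.outDeg_add_inDeg [Finite V] (hD : IsOrientation D G)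
    (hreg : ∀ v, (G.neighborSet v).ncard = 4) (v : V) :
    outDeg D v + {u | D.Adj u v}.ncard = 4 := by
  rw [← hreg v, outDeg, ← Set.ncard_union_eq]
  · congr 1
    ext u
    simp [hD.adj_iff]
  · rw [Set.disjoint_left]
    exact fun u hu => hD.asymm _ _ hu

theorem IsOrientation.outDeg_push_self [Finite V] (hD : IsOrientation D G)
    (hreg : ∀ v, (G.neighborSet v).ncard = 4) (v : V) :
    outDeg D v + outDeg (pushVertex D v) v = 4 := by
  rw [← hD.outDeg_add_inDeg hreg v]
  simp [outDeg, pushVertex_adj_left]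

theorem not_adj_of_outDeg_eq_zero [Finite V] (h : outDeg D v = 0) (u : V) : ¬ D.Adj v u := by
  rw [outDeg, Set.ncard_eq_zero] at h
  exact Set.eq_empty_iff_forall_notMem.1 h u

theorem exists_adj_iff_of_outDeg_eq_one (h : outDeg D v = 1) :
    ∃ x, ∀ u, D.Adj v u ↔ u = x := by
  obtain ⟨x, hx⟩ := Set.ncard_eq_one.1 h
  exact ⟨x, fun u => Set.ext_iff.1 hx u⟩

theorem exists_adj_iff_of_outDeg_eq_two {y : V} (h : outDeg D v = 2) (hy : D.Adj v y) :
    ∃ x, x ≠ y ∧ ∀ u, D.Adj v u ↔ u = x ∨ u = y := by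
  obtain ⟨a, b, hab, hset⟩ := Set.ncard_eq_two.1 h
  have hout : ∀ u, D.Adj v u ↔ u = a ∨ u = b := fun u => Set.ext_iff.1 hset u
  rcases (hout y).1 hy with rfl | rfl
  · exact ⟨b, hab.symm, fun u => (hout u).trans or_comm⟩
  · exact ⟨a, hab, hout⟩

theorem outDeg_eq_two {x y : V} (hxy : x ≠ y) (hout : ∀ u, D.Adj v u ↔ u = x ∨ u = y) :
    outDeg D v = 2 := by
  rw [outDeg, ← Set.ncard_pair hxy]
  congr 1
  ext u
  exact hout u

end Push

/-! ### Robbers with few ways out -/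

theorem exists_adj_dist_eq {V : Type*} {G : SimpleGraph V} (hconn : G.Connected) {a b : V}
    {n : ℕ} (h : G.dist a b = n + 1) : ∃ u, G.Adj a u ∧ G.dist u b = n := by
  obtain ⟨p, hp⟩ := hconn.exists_walk_length_eq_dist a b
  cases p with
  | nil => simp at h
  | @cons _ u _ hau q =>
    refine ⟨u, hau, ?_⟩
    have h1 : G.dist u b ≤ q.length := SimpleGraph.dist_le q
    have h2 : G.dist a b ≤ G.dist a u + G.dist u b := hconn.dist_triangle
    have h3 : G.dist a u = 1 := SimpleGraph.dist_eq_one_iff_adj.2 hau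
    rw [SimpleGraph.Walk.length_cons] at hp
    omega

section Few

variable {V : Type*} [Finite V] {G : SimpleGraph V} {D : Digraph V} {r : V}

/-- The cop walks to a robber on a sink. At distance at least two from the robber it may push its
own vertex whenever the next arc has the wrong direction, as this keeps the sink. -/
theorem doomed_of_sink (hconn : G.Connected) (hD : IsOrientation D G)
    (hsink : ∀ u, ¬ D.Adj r u) : Doomed D r := by
  intro c
  induction hn : G.dist c r generalizing D c with
  | zero =>
    rw [(hconn.dist_eq_zero_iff).1 hn]
    exact catchable_self D r
  | succ n ih =>
    by_cases hcr : G.Adj c r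
    · exact catchable_of_adj (((hD.adj_iff c r).1 hcr).resolve_right (hsink c))
    have hne : c ≠ r := by
      rintro rfl
      simp at hn
    obtain ⟨u, hcu, hu⟩ := exists_adj_dist_eq hconn hn
    have walk : ∀ {D : Digraph V}, IsOrientation D G → (∀ u, ¬ D.Adj r u) → D.Adj c u →
        Catchable D c r := fun hD hsink hcu => catchable_of_move hcu fun r' hr' => by
      rw [hr'.resolve_right (hsink r')]
      exact ih hD hsink u hu
    rcases (hD.adj_iff c u).1 hcu with h | h
    · exact walk hD hsink h
    · have hsink' : ∀ u, ¬ (pushVertex D c).Adj r u := by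
        intro u hu
        by_cases huc : u = c
        · subst huc
          exact hcr ((hD.push u).adj hu).symm
        · exact hsink u ((pushVertex_adj_of_ne hne.symm huc).1 hu)
      refine catchable_of_push c fun r' hr' => ?_
      rw [hr'.resolve_right (hsink' r')]
      exact walk (hD.push c) hsink' (pushVertex_adj_left.2 h)

end Few

section Few

variable {V : Type*} [Finite V] {G : SimpleGraph V} {D : Digraph V} {r x y : V}

theorem doomed_of_outDeg_eq_zero (hconn : G.Connected) (hD : IsOrientation D G)
    (h : outDeg D r = 0) : Doomed D r :=
  doomed_of_sink hconn hD (not_adj_of_outDeg_eq_zero h)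

theorem doomed_of_outDeg_eq_one (hconn : G.Connected) (hD : IsOrientation D G)
    (h : outDeg D r = 1) : Doomed D r := by
  obtain ⟨x, hx⟩ := exists_adj_iff_of_outDeg_eq_one h
  have hrx : D.Adj r x := (hx x).2 rfl
  have h0 : outDeg (pushVertex D x) r = 0 := by
    have := hD.outDeg_push_of_out hrx
    omega
  refine .of_push x fun r' hr' => ?_
  rw [hr'.resolve_right (not_adj_of_outDeg_eq_zero h0 r')]
  exact doomed_of_outDeg_eq_zero hconn (hD.push x) h0

theorem doomed_of_outDeg_eq_four (hconn : G.Connected)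
    (hreg : ∀ v, (G.neighborSet v).ncard = 4) (hD : IsOrientation D G)
    (h : outDeg D r = 4) : Doomed D r := by
  have h0 : outDeg (pushVertex D r) r = 0 := by
    have := hD.outDeg_push_self hreg r
    omega
  refine .of_push r fun r' hr' => ?_
  rw [hr'.resolve_right (not_adj_of_outDeg_eq_zero h0 r')]
  exact doomed_of_outDeg_eq_zero hconn (hD.push r) h0

/-- Pushing one of the two out-neighbours of the robber forces it to the other one, as it
otherwise stays on a vertex of out-degree one. -/
theorem doomed_of_force (hconn : G.Connected) (hD : IsOrientation D G) (hxy : x ≠ y)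
    (hout : ∀ u, D.Adj r u ↔ u = x ∨ u = y) (h : Doomed (pushVertex D x) y) : Doomed D r := by
  have hrx : D.Adj r x := (hout x).2 (Or.inl rfl)
  refine .of_push x fun r' hr' => ?_
  rcases hr' with rfl | hr'
  · have := hD.outDeg_push_of_out hrx
    have := outDeg_eq_two hxy hout
    exact doomed_of_outDeg_eq_one hconn (hD.push x) (by omega)
  · by_cases hx : r' = x
    · subst hx
      exact absurd (pushVertex_adj_right.1 hr') (hD.asymm _ _ hrx)
    · rw [pushVertex_adj_of_ne (hD.ne hrx) hx, hout] at hr'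
      rwa [hr'.resolve_left hx]

/-- Pushing a robber with out-degree three forces it to its only in-neighbour. -/
theorem doomed_of_force_back (hconn : G.Connected)
    (hreg : ∀ v, (G.neighborSet v).ncard = 4) (hD : IsOrientation D G)
    (hr : outDeg D r = 3) (hyr : D.Adj y r) (h : Doomed (pushVertex D r) y) : Doomed D r := by
  have h1 : outDeg (pushVertex D r) r = 1 := by
    have := hD.outDeg_push_self hreg r
    omega
  refine .of_push r fun r' hr' => ?_
  rcases hr' with rfl | hr'
  · exact doomed_of_outDeg_eq_one hconn (hD.push _) h1
  · obtain ⟨z, hz⟩ := exists_adj_iff_of_outDeg_eq_one h1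
    have hy := (hz y).1 (pushVertex_adj_left.2 hyr)
    rwa [(hz r').1 hr', ← hy]

/-- A robber that moves from a vertex of out-degree at most two to a vertex of out-degree other
than two is lost: if the new out-degree is three, it is forced back, and finds one arc less. -/
theorem doomed_of_adj (hconn : G.Connected)
    (hreg : ∀ v, (G.neighborSet v).ncard = 4) (hD : IsOrientation D G)
    (hry : D.Adj r y) (hr : outDeg D r ≤ 2) (hy : outDeg D y ≠ 2) : Doomed D y := by
  have h4 := hD.outDeg_add_inDeg hreg y
  have hcases : outDeg D y = 0 ∨ outDeg D y = 1 ∨ outDeg D y = 3 ∨ outDeg D y = 4 := by omega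
  rcases hcases with h | h | h | h
  · exact doomed_of_outDeg_eq_zero hconn hD h
  · exact doomed_of_outDeg_eq_one hconn hD h
  · refine doomed_of_force_back hconn hreg hD h hry ?_
    have h1 := hD.outDeg_push_of_out hry
    have h2 : outDeg (pushVertex D y) r = 0 ∨ outDeg (pushVertex D y) r = 1 := by omega
    rcases h2 with h2 | h2
    · exact doomed_of_outDeg_eq_zero hconn (hD.push y) h2
    · exact doomed_of_outDeg_eq_one hconn (hD.push y) h2
  · exact doomed_of_outDeg_eq_four hconn hreg hD h

end Few

/-! ### The two out-neighbours of the robber -/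

section Two

variable {V : Type*} [Finite V] {G : SimpleGraph V} {D : Digraph V} {c r x y : V}

/-- If the robber's two out-neighbours are joined by the arc `x → y`, a cop on `y` attacks, after
pushing `y`, both the robber and its only refuge `x`. -/
theorem catchable_of_cop_on_head (hD : IsOrientation D G)
    (hout : ∀ u, D.Adj r u ↔ u = x ∨ u = y) (hxy : D.Adj x y) : Catchable D y r := by
  have hry : D.Adj r y := (hout y).2 (Or.inr rfl)
  refine catchable_of_push y fun r' hr' => ?_
  rcases hr' with rfl | hr'
  · exact catchable_of_adj (pushVertex_adj_left.2 hry)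
  · by_cases hy : r' = y
    · subst hy
      exact catchable_self _ _
    · rw [pushVertex_adj_of_ne (hD.ne hry) hy, hout] at hr'
      rw [hr'.resolve_right hy]
      exact catchable_of_adj (pushVertex_adj_left.2 hxy)

/-- A cop on `x`, one of the two out-neighbours of the robber, pushes `y` and leaves the robber
only the arc to the cop. -/
theorem catchable_of_cop_on_out (hconn : G.Connected) (hD : IsOrientation D G) (hxy : x ≠ y)
    (hout : ∀ u, D.Adj r u ↔ u = x ∨ u = y) : Catchable D x r := by
  have hry : D.Adj r y := (hout y).2 (Or.inr rfl)
  refine catchable_of_push y fun r' hr' => ?_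
  rcases hr' with rfl | hr'
  · have := hD.outDeg_push_of_out hry
    have := outDeg_eq_two hxy hout
    exact doomed_of_outDeg_eq_one hconn (hD.push y) (by omega) _
  · by_cases hy : r' = y
    · subst hy
      exact absurd (pushVertex_adj_right.1 hr') (hD.asymm _ _ hry)
    · rw [pushVertex_adj_of_ne (hD.ne hry) hy, hout] at hr'
      rw [hr'.resolve_right hy]
      exact catchable_self _ _

/-- A robber whose out-neighbours `x → y` both have out-degree other than two may only wait. The
cop walks to it; a push of the cop's own vertex `c` changes the out-degree of `x` or `y` only if
that vertex is adjacent to `c`, and then it is attacked by the cop. -/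
theorem doomed_of_triangle (hconn : G.Connected)
    (hreg : ∀ v, (G.neighborSet v).ncard = 4) (hD : IsOrientation D G)
    (hout : ∀ u, D.Adj r u ↔ u = x ∨ u = y) (hxy : D.Adj x y)
    (hx : outDeg D x ≠ 2) (hy : outDeg D y ≠ 2) : Doomed D r := by
  intro c
  induction hn : G.dist c r using Nat.strong_induction_on generalizing D c with
  | _ n ih =>
  have hne := hD.ne hxy
  have hrx : D.Adj r x := (hout x).2 (Or.inl rfl)
  have hry : D.Adj r y := (hout y).2 (Or.inr rfl)
  have hr2 : outDeg D r = 2 := outDeg_eq_two hne hout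
  by_cases hcx : c = x
  · subst hcx
    exact catchable_of_cop_on_out hconn hD hne hout
  by_cases hcy : c = y
  · subst hcy
    exact catchable_of_cop_on_head hD hout hxy
  by_cases hcr : c = r
  · subst hcr
    exact catchable_self _ _
  by_cases hadj : G.Adj c r
  · refine catchable_of_adj (((hD.adj_iff c r).1 hadj).resolve_right fun h => ?_)
    exact ((hout c).1 h).elim hcx hcy
  -- `D'` is `D` or the result of pushing `c`
  have walk : ∀ {D' : Digraph V} {u : V}, IsOrientation D' G →
      (∀ v, D'.Adj r v ↔ v = x ∨ v = y) → D'.Adj x y → D'.Adj c u →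
      (u = x ∨ (u = y ∧ outDeg D' x ≠ 2) ∨
        (G.dist u r < n ∧ outDeg D' x ≠ 2 ∧ outDeg D' y ≠ 2)) → Catchable D' c r := by
    intro D' u hD' hout' hxy' hcu hu
    have hr2' : outDeg D' r = 2 := outDeg_eq_two hne hout'
    have hrx' : D'.Adj r x := (hout' x).2 (Or.inl rfl)
    have hry' : D'.Adj r y := (hout' y).2 (Or.inr rfl)
    refine catchable_of_move hcu fun r' hr' => ?_
    rw [hout'] at hr'
    rcases hu with rfl | ⟨rfl, hx'⟩ | ⟨hlt, hx', hy'⟩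
    · rcases hr' with rfl | rfl | rfl
      · exact catchable_of_cop_on_out hconn hD' hne hout'
      · exact catchable_self _ _
      · exact catchable_of_adj hxy'
    · rcases hr' with rfl | rfl | rfl
      · exact catchable_of_cop_on_head hD' hout' hxy'
      · exact doomed_of_adj hconn hreg hD' hrx' hr2'.le hx' _
      · exact catchable_self _ _
    · rcases hr' with rfl | rfl | rfl
      · exact ih _ hlt hD' hout' hxy' hx' hy' u rfl
      · exact doomed_of_adj hconn hreg hD' hrx' hr2'.le hx' _
      · exact doomed_of_adj hconn hreg hD' hry' hr2'.le hy' _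
  by_cases hcx' : D.Adj c x
  · exact walk hD hout hxy hcx' (Or.inl rfl)
  by_cases hcy' : D.Adj c y
  · exact walk hD hout hxy hcy' (Or.inr (Or.inl ⟨rfl, hx⟩))
  -- From here on, the arcs between `c` and `x` or `y` enter `c`.
  have hpush : ∀ v, c ≠ v → ¬ D.Adj c v → outDeg D v ≠ 2 →
      (pushVertex D c).Adj c v ∨ outDeg (pushVertex D c) v ≠ 2 := by
    intro v hcv hncv hv
    by_cases hvc : D.Adj v c
    · exact Or.inl (pushVertex_adj_left.2 hvc)
    · right
      rwa [hD.outDeg_push_of_not_adj hcv.symm fun h => ((hD.adj_iff v c).1 h).elim hvc hncv]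
  have hpx := hpush x hcx hcx' hx
  have hpy := hpush y hcy hcy' hy
  obtain ⟨m, rfl⟩ : ∃ m, n = m + 1 := Nat.exists_eq_succ_of_ne_zero (by
    rintro rfl
    exact hcr (hconn.dist_eq_zero_iff.1 hn))
  obtain ⟨u, hcu, hu⟩ := exists_adj_dist_eq hconn hn
  rcases (hD.adj_iff c u).1 hcu with h | h
  · exact walk hD hout hxy h (Or.inr (Or.inr ⟨by omega, hx, hy⟩))
  have hD' := hD.push c
  have hout' : ∀ v, (pushVertex D c).Adj r v ↔ v = x ∨ v = y := by
    intro v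
    by_cases hv : v = c
    · subst hv
      have h1 : ¬ (pushVertex D v).Adj r v := fun h => hadj (hD'.adj h).symm
      simp [h1, hcx, hcy]
    · rw [pushVertex_adj_of_ne (Ne.symm hcr) hv, hout]
  have hxy' : (pushVertex D c).Adj x y :=
    (pushVertex_adj_of_ne (Ne.symm hcx) (Ne.symm hcy)).2 hxy
  have hr2' : outDeg (pushVertex D c) r ≤ 2 := (outDeg_eq_two hne hout').le
  refine catchable_of_push c fun r' hr' => ?_
  rw [hout'] at hr'
  rcases hr' with rfl | rfl | rfl
  · rcases hpx with hpx | hpx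
    · exact walk hD' hout' hxy' hpx (Or.inl rfl)
    rcases hpy with hpy | hpy
    · exact walk hD' hout' hxy' hpy (Or.inr (Or.inl ⟨rfl, hpx⟩))
    exact walk hD' hout' hxy' (pushVertex_adj_left.2 h) (Or.inr (Or.inr ⟨by omega, hpx, hpy⟩))
  · exact hpx.elim catchable_of_adj fun hpx =>
      doomed_of_adj hconn hreg hD' ((hout' _).2 (Or.inl rfl)) hr2' hpx _
  · exact hpy.elim catchable_of_adj fun hpy =>
      doomed_of_adj hconn hreg hD' ((hout' _).2 (Or.inr rfl)) hr2' hpy _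

/-- A robber with two out-neighbours is lost as soon as they are adjacent or one of them has
out-degree other than two: a forcing push sends it to a vertex of out-degree other than two,
unless the triangle situation of `doomed_of_triangle` occurs. -/
theorem doomed_of_irregular (hconn : G.Connected)
    (hreg : ∀ v, (G.neighborSet v).ncard = 4) (hD : IsOrientation D G) (hne : x ≠ y)
    (hout : ∀ u, D.Adj r u ↔ u = x ∨ u = y)
    (h : G.Adj x y ∨ outDeg D x ≠ 2 ∨ outDeg D y ≠ 2) : Doomed D r := by
  have hout' : ∀ u, D.Adj r u ↔ u = y ∨ u = x := fun u => (hout u).trans or_comm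
  have hr2 := outDeg_eq_two hne hout
  have force : ∀ {x y : V}, x ≠ y → (∀ u, D.Adj r u ↔ u = x ∨ u = y) →
      outDeg (pushVertex D x) y ≠ 2 → Doomed D r := by
    intro x y hne hout hy
    have hrx : D.Adj r x := (hout x).2 (Or.inl rfl)
    have hry : D.Adj r y := (hout y).2 (Or.inr rfl)
    have hr := hD.outDeg_push_of_out hrx
    exact doomed_of_force hconn hD hne hout (doomed_of_adj hconn hreg (hD.push x)
      ((pushVertex_adj_of_ne (hD.ne hrx) hne.symm).2 hry) (by omega) hy)
  have arc : ∀ {x y : V}, x ≠ y → (∀ u, D.Adj r u ↔ u = x ∨ u = y) → D.Adj x y →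
      Doomed D r := by
    intro x y hne hout hxy
    have hout' : ∀ u, D.Adj r u ↔ u = y ∨ u = x := fun u => (hout u).trans or_comm
    have hy := hD.outDeg_push_of_in hxy
    have hx := hD.outDeg_push_of_out hxy
    by_cases hy1 : outDeg D y = 1
    · by_cases hx3 : outDeg D x = 3
      · exact doomed_of_triangle hconn hreg hD hout hxy (by omega) (by omega)
      · exact force hne.symm hout' (by omega)
    · exact force hne hout (by omega)
  by_cases hadj : G.Adj x y
  · rcases (hD.adj_iff x y).1 hadj with h1 | h1
    · exact arc hne hout h1
    · exact arc hne.symm hout' h1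
  rcases h.resolve_left hadj with hx | hy
  · refine force hne.symm hout' ?_
    rwa [hD.outDeg_push_of_not_adj hne hadj]
  · refine force hne hout ?_
    rwa [hD.outDeg_push_of_not_adj hne.symm fun h => hadj h.symm]

end Two

/-! ### Leading the robber along a walk -/

section Walk

variable {V : Type*} [Finite V] {G : SimpleGraph V} {D : Digraph V} {r x y t : V}

/-- A walk of two arcs from the robber's vertex to a vertex `t` of out-degree other than two is
enough if the forcing push does not touch `t`. -/
theorem doomed_of_two_step (hconn : G.Connected)
    (hreg : ∀ v, (G.neighborSet v).ncard = 4) (hD : IsOrientation D G) (hne : x ≠ y)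
    (hout : ∀ u, D.Adj r u ↔ u = x ∨ u = y) (hyt : D.Adj y t) (htx : ¬ G.Adj t x)
    (ht : outDeg D t ≠ 2) : Doomed D r := by
  by_cases hirr : G.Adj x y ∨ outDeg D x ≠ 2 ∨ outDeg D y ≠ 2
  · exact doomed_of_irregular hconn hreg hD hne hout hirr
  push Not at hirr
  obtain ⟨hxy, -, hy⟩ := hirr
  refine doomed_of_force hconn hD hne hout ?_
  have hxt : t ≠ x := by
    rintro rfl
    exact hxy (hD.adj hyt).symm
  rw [← hD.outDeg_push_of_not_adj hne.symm fun h => hxy h.symm] at hy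
  obtain ⟨q, hq, hqout⟩ := exists_adj_iff_of_outDeg_eq_two hy
    ((pushVertex_adj_of_ne hne.symm hxt).2 hyt)
  refine doomed_of_irregular hconn hreg (hD.push x) hq hqout (Or.inr (Or.inr ?_))
  rwa [hD.outDeg_push_of_not_adj hxt htx]

/-- The one configuration in which every forcing push repairs the out-degree of the vertex at
distance two: both out-neighbours `x`, `y` of the robber have an arc to a vertex `t` of
out-degree one. -/
theorem doomed_of_diamond (hconn : G.Connected)
    (hreg : ∀ v, (G.neighborSet v).ncard = 4) (hD : IsOrientation D G) (hne : x ≠ y)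
    (hout : ∀ u, D.Adj r u ↔ u = x ∨ u = y) (hxt : D.Adj x t) (hyt : D.Adj y t)
    (ht : outDeg D t = 1) : Doomed D r := by
  by_cases hirr : G.Adj x y ∨ outDeg D x ≠ 2 ∨ outDeg D y ≠ 2
  · exact doomed_of_irregular hconn hreg hD hne hout hirr
  push Not at hirr
  obtain ⟨hxy, hx, hy⟩ := hirr
  have hr2 := outDeg_eq_two hne hout
  have hrx : D.Adj r x := (hout x).2 (Or.inl rfl)
  have hry : D.Adj r y := (hout y).2 (Or.inr rfl)
  have hrt : ¬ D.Adj r t := by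
    rw [hout]
    rintro (rfl | rfl)
    · omega
    · omega
  have hrt' : r ≠ t := by
    rintro rfl
    omega
  by_cases htr : D.Adj t r
  · -- Unless `x` and `y` have the same second out-neighbour `w`, the robber can be forced to one
    -- of them and from there, through `t`, back to its vertex, which has lost an arc.
    have second : ∀ {x y : V}, x ≠ y → (∀ u, D.Adj r u ↔ u = x ∨ u = y) → ¬ G.Adj x y →
        D.Adj x t → D.Adj y t → outDeg D y = 2 →
        Doomed D r ∨ ∃ q, q ≠ t ∧ D.Adj y q ∧ D.Adj q r := by
      intro x y hne hout hxy hxt hyt hy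
      have hrx : D.Adj r x := (hout x).2 (Or.inl rfl)
      have hry : D.Adj r y := (hout y).2 (Or.inr rfl)
      obtain ⟨q, hqt, hq⟩ := exists_adj_iff_of_outDeg_eq_two hy hyt
      have hyq : D.Adj y q := (hq q).2 (Or.inl rfl)
      by_cases hqr : D.Adj q r
      · exact Or.inr ⟨q, hqt, hyq, hqr⟩
      left
      have hqx : q ≠ x := by
        rintro rfl
        exact hxy (hD.adj hyq).symm
      have hrq : ¬ G.Adj r q := by
        rw [hD.adj_iff, hout]
        rintro ((h | h) | h)
        · exact hqx h
        · exact hD.ne hyq h.symm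
        · exact hqr h
      refine doomed_of_force hconn hD hne hout ?_
      refine doomed_of_two_step hconn hreg (hD.push x) (x := q) (y := t) (t := r) hqt ?_
        ((pushVertex_adj_of_ne (hD.ne hxt).symm (hD.ne hrx)).2 htr) hrq ?_
      · intro u
        by_cases hu : u = x
        · subst hu
          have h1 : ¬ (pushVertex D u).Adj y u := fun h => hxy ((hD.push u).adj h).symm
          simp [h1, hqx.symm, hD.ne hxt]
        · rw [pushVertex_adj_of_ne hne.symm hu, hq]
      · have := hD.outDeg_push_of_out hrx
        omega
    have hout' : ∀ u, D.Adj r u ↔ u = y ∨ u = x := fun u => (hout u).trans or_comm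
    rcases second hne hout hxy hxt hyt hy with h | ⟨w, hwt, hyw, hwr⟩
    · exact h
    rcases second hne.symm hout' (fun h => hxy h.symm) hyt hxt hx with h | ⟨p, hpt, hxp, hpr⟩
    · exact h
    -- the in-neighbours of `r` are `t` and one further vertex
    have hpw : p = w := by
      have hin : outDeg (pushVertex D r) r = 2 := by
        have := hD.outDeg_push_self hreg r
        omega
      obtain ⟨z, -, hz⟩ := exists_adj_iff_of_outDeg_eq_two hin (pushVertex_adj_left.2 htr)
      have h1 := ((hz p).1 (pushVertex_adj_left.2 hpr)).resolve_right hpt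
      have h2 := ((hz w).1 (pushVertex_adj_left.2 hwr)).resolve_right hwt
      rw [h1, h2]
    subst hpw
    -- Pushing `r` leaves `t` with out-degree zero and `w` with out-degree at most one.
    have hw : outDeg D p ≤ 2 := by
      have h1 := hD.outDeg_add_inDeg hreg p
      have h2 : 2 ≤ {u | D.Adj u p}.ncard := by
        rw [← Set.ncard_pair hne]
        refine Set.ncard_le_ncard ?_
        rintro u (rfl | rfl)
        · exact hxp
        · exact hyw
      omega
    have ht' := hD.outDeg_push_of_out htr
    have hp' := hD.outDeg_push_of_out hpr
    have hr' := hD.outDeg_push_self hreg r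
    obtain ⟨z, -, hz⟩ := exists_adj_iff_of_outDeg_eq_two (v := r) (D := pushVertex D r)
      (by omega) (pushVertex_adj_left.2 htr)
    have hzp := ((hz p).1 (pushVertex_adj_left.2 hpr)).resolve_right hpt
    subst hzp
    refine .of_push r fun r' hr'' => ?_
    rw [hz] at hr''
    rcases hr'' with rfl | rfl | rfl
    · exact doomed_of_irregular hconn hreg (hD.push _) hpt hz (Or.inr (Or.inr (by omega)))
    · exact doomed_of_adj hconn hreg (hD.push _) ((hz _).2 (Or.inl rfl)) (by omega) (by omega)
    · exact doomed_of_adj hconn hreg (hD.push _) ((hz _).2 (Or.inr rfl)) (by omega) (by omega)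
  · -- Pushing `t` changes the out-degrees of `x` and `y` and nothing at `r`.
    have hx' := hD.outDeg_push_of_out hxt
    have hy' := hD.outDeg_push_of_out hyt
    have hr' : outDeg (pushVertex D t) r = 2 := by
      rw [hD.outDeg_push_of_not_adj hrt' fun h => ((hD.adj_iff r t).1 h).elim hrt htr, hr2]
    have hout' : ∀ u, (pushVertex D t).Adj r u ↔ u = x ∨ u = y := by
      intro u
      by_cases hu : u = t
      · subst hu
        simp [pushVertex_adj_right, htr, (hD.ne hxt).symm, (hD.ne hyt).symm]
      · rw [pushVertex_adj_of_ne hrt' hu, hout]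
    refine .of_push t fun r' hr'' => ?_
    rw [hout'] at hr''
    rcases hr'' with rfl | rfl | rfl
    · exact doomed_of_irregular hconn hreg (hD.push _) hne hout' (Or.inr (Or.inr (by omega)))
    · exact doomed_of_adj hconn hreg (hD.push _) ((hout' _).2 (Or.inl rfl)) hr'.le (by omega)
    · exact doomed_of_adj hconn hreg (hD.push _) ((hout' _).2 (Or.inr rfl)) hr'.le (by omega)

/-- In every orientation of `G`, a robber with out-degree two is lost if a directed walk of
length `k` leads from its vertex to a vertex of out-degree other than two. -/
def WalkDooms (G : SimpleGraph V) (k : ℕ) : Prop :=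
  ∀ (D : Digraph V) (f : ℕ → V), IsOrientation D G → outDeg D (f 0) = 2 →
    (∀ i < k, D.Adj (f i) (f (i + 1))) → outDeg D (f k) ≠ 2 → Doomed D (f 0)

theorem walkDooms_one (hconn : G.Connected) (hreg : ∀ v, (G.neighborSet v).ncard = 4) :
    WalkDooms G 1 := by
  intro D f hD h0 hf hk
  obtain ⟨x, hne, hout⟩ := exists_adj_iff_of_outDeg_eq_two h0 (hf 0 one_pos)
  exact doomed_of_irregular hconn hreg hD hne hout (Or.inr (Or.inr hk))

/-- Forcing the robber to the second vertex of a shortest walk brings it closer to the end of the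
walk, unless this push of the other out-neighbour `x` changes the out-degree of the end to two. -/
theorem doomed_or_exists_blocker (hconn : G.Connected)
    (hreg : ∀ v, (G.neighborSet v).ncard = 4) {k : ℕ} (ih : ∀ j < k, WalkDooms G j) (hk : 2 ≤ k)
    (hD : IsOrientation D G) (f : ℕ → V) (h0 : outDeg D (f 0) = 2)
    (hf : ∀ i < k, D.Adj (f i) (f (i + 1))) (ht : outDeg D (f k) ≠ 2) :
    Doomed D (f 0) ∨ ∃ x, x ≠ f 1 ∧ (∀ u, D.Adj (f 0) u ↔ u = x ∨ u = f 1) ∧ ¬ G.Adj x (f 1) ∧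
      (∀ i ≤ k, f i ≠ x) ∧ outDeg (pushVertex D x) (f 1) = 2 ∧ outDeg D x = 2 ∧
      outDeg (pushVertex D x) (f k) = 2 := by
  by_cases hdoom : Doomed D (f 0)
  · exact Or.inl hdoom
  right
  have hf0 : D.Adj (f 0) (f 1) := hf 0 (by omega)
  obtain ⟨x, hne, hout⟩ := exists_adj_iff_of_outDeg_eq_two h0 hf0
  have hrx : D.Adj (f 0) x := (hout x).2 (Or.inl rfl)
  have hirr : ¬ (G.Adj x (f 1) ∨ outDeg D x ≠ 2 ∨ outDeg D (f 1) ≠ 2) :=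
    fun h => hdoom (doomed_of_irregular hconn hreg hD hne hout h)
  push Not at hirr
  obtain ⟨hxy, hx, hy⟩ := hirr
  have hy' : outDeg (pushVertex D x) (f 1) = 2 := by
    rw [hD.outDeg_push_of_not_adj hne.symm fun h => hxy h.symm, hy]
  have hfx : ∀ i ≤ k, f i ≠ x := by
    intro i hi hix
    have hi0 : i ≠ 0 := by
      rintro rfl
      exact hD.ne hrx hix
    have hi1 : i ≠ 1 := by
      rintro rfl
      exact hne hix.symm
    -- the arc from `f 0` to `x = f i` is a shortcut
    let g : ℕ → V := fun j => if j = 0 then f 0 else f (j + (i - 1))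
    refine hdoom (ih (k - (i - 1)) (by omega) D g hD h0 ?_ ?_)
    · intro j hj
      by_cases hj0 : j = 0
      · subst hj0
        have : 0 + 1 + (i - 1) = i := by omega
        simp only [g, if_true, Nat.add_eq_zero_iff, one_ne_zero, and_false, if_false, this, hix]
        exact hrx
      · have : j + 1 + (i - 1) = j + (i - 1) + 1 := by omega
        simp only [g, hj0, Nat.add_eq_zero_iff, one_ne_zero, and_false, if_false, this]
        exact hf _ (by omega)
    · have h1 : k - (i - 1) ≠ 0 := by omega
      have h2 : k - (i - 1) + (i - 1) = k := by omega
      simpa only [g, h1, if_false, h2] using ht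
  refine ⟨x, hne, hout, hxy, hfx, hy', hx, ?_⟩
  by_contra hk2
  refine hdoom (doomed_of_force hconn hD hne hout ?_)
  refine ih (k - 1) (by omega) (pushVertex D x) (fun i => f (i + 1)) (hD.push x) hy' ?_ ?_
  · intro i hi
    exact (pushVertex_adj_of_ne (hfx _ (by omega)) (hfx _ (by omega))).2 (hf _ (by omega))
  · have : k - 1 + 1 = k := by omega
    simpa only [this] using hk2

theorem outDeg_of_push_eq_two (hD : IsOrientation D G) (hne : t ≠ x) (ht : outDeg D t ≠ 2)
    (h : outDeg (pushVertex D x) t = 2) :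
    (outDeg D t = 1 ∧ D.Adj x t) ∨ (outDeg D t = 3 ∧ D.Adj t x) := by
  by_cases hadj : G.Adj t x
  · rcases (hD.adj_iff t x).1 hadj with h1 | h1
    · have := hD.outDeg_push_of_out h1
      exact Or.inr ⟨by omega, h1⟩
    · have := hD.outDeg_push_of_in h1
      exact Or.inl ⟨by omega, h1⟩
  · rw [hD.outDeg_push_of_not_adj hne hadj] at h
    exact absurd h ht

/-- If the end of the walk does not have out-degree three, the push of `x` repairs its out-degree
only if it is one and `x` has an arc to it, so that the distance is two. -/
theorem doomed_of_walk_of_outDeg_ne_three (hconn : G.Connected)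
    (hreg : ∀ v, (G.neighborSet v).ncard = 4) {k : ℕ} (ih : ∀ j < k, WalkDooms G j) (hk : 2 ≤ k)
    (hD : IsOrientation D G) (f : ℕ → V) (h0 : outDeg D (f 0) = 2)
    (hf : ∀ i < k, D.Adj (f i) (f (i + 1))) (ht : outDeg D (f k) ≠ 2)
    (ht3 : outDeg D (f k) ≠ 3) : Doomed D (f 0) := by
  rcases doomed_or_exists_blocker hconn hreg ih hk hD f h0 hf ht with
    h | ⟨x, hne, hout, hxy, hfx, hy', hx, hk2⟩
  · exact h
  obtain ⟨ht1, hxt⟩ := (outDeg_of_push_eq_two hD (hfx k le_rfl) ht hk2).resolve_right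
    fun h => ht3 h.1
  have hrx : D.Adj (f 0) x := (hout x).2 (Or.inl rfl)
  rcases hk.eq_or_lt with rfl | hlt
  · exact doomed_of_diamond hconn hreg hD hne hout hxt (hf 1 (by omega)) ht1
  · -- the end is at distance two, through `x`
    refine ih 2 hlt D (fun i => if i = 0 then f 0 else if i = 1 then x else f k) hD h0 ?_ ht
    intro i hi
    interval_cases i
    · exact hrx
    · exact hxt

theorem walkDooms (hconn : G.Connected) (hreg : ∀ v, (G.neighborSet v).ncard = 4) (k : ℕ) :
    WalkDooms G k := by
  induction k using Nat.strong_induction_on with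
  | _ k ih =>
  rcases Nat.lt_or_ge k 2 with hk | hk
  · interval_cases k
    · exact fun D f _ h0 _ hk => absurd h0 hk
    · exact walkDooms_one hconn hreg
  intro D f hD h0 hf ht
  rcases doomed_or_exists_blocker hconn hreg ih hk hD f h0 hf ht with
    h | ⟨x, hne, hout, hxy, hfx, hy', hx, hk2⟩
  · exact h
  rcases outDeg_of_push_eq_two hD (hfx k le_rfl) ht hk2 with ⟨ht1, -⟩ | ⟨ht3, htx⟩
  · exact doomed_of_walk_of_outDeg_ne_three hconn hreg ih hk hD f h0 hf ht (by omega)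
  have hrx : D.Adj (f 0) x := (hout x).2 (Or.inl rfl)
  have hr1 : D.Adj (f 0) (f 1) := (hout _).2 (Or.inr rfl)
  by_cases hdoom : Doomed D (f 0)
  · exact hdoom
  have hint : ∀ i < k, outDeg D (f i) = 2 := fun i hi => by
    by_contra h
    exact hdoom (ih i hi D f hD h0 (fun j hj => hf j (hj.trans hi)) h)
  have hit : ∀ i < k, f i ≠ f k := fun i hi h => by
    have := hint i hi
    rw [h] at this
    exact ht this
  have hrt : ¬ D.Adj (f 0) (f k) := by
    rw [hout]
    rintro (h | h)
    · exact hfx k le_rfl h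
    · exact hit 1 (by omega) h.symm
  by_cases htr : D.Adj (f k) (f 0)
  · -- Once the robber is forced to `f 1`, the walk can be continued to `f 0`, which has lost an
    -- arc.
    refine doomed_of_force hconn hD hne hout ?_
    let g : ℕ → V := fun i => if i = k then f 0 else f (i + 1)
    have hg0 : g 0 = f 1 := if_neg (by omega)
    have hr := hD.outDeg_push_of_out hrx
    have hgk : outDeg (pushVertex D x) (g k) = 1 := by
      simp only [g, if_true]
      omega
    rw [← hg0] at hy' ⊢
    refine doomed_of_walk_of_outDeg_ne_three hconn hreg ih hk (hD.push x) g hy' ?_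
      (by omega) (by omega)
    intro i hi
    have hik : i ≠ k := hi.ne
    by_cases hi' : i + 1 = k
    · simp only [g, hik, hi', if_true, if_false]
      exact (pushVertex_adj_of_ne (hfx k le_rfl) (hfx 0 (by omega))).2 htr
    · simp only [g, hik, hi', if_false]
      exact (pushVertex_adj_of_ne (hfx _ (by omega)) (hfx _ (by omega))).2 (hf _ (by omega))
  · -- Pushing the end `f k` of the walk changes the out-degrees of `x` and `f (k - 1)`, and
    -- nothing at `f 0`.
    have hD' := hD.push (f k)
    have hrk : f 0 ≠ f k := hit 0 (by omega)
    have hout' : ∀ u, (pushVertex D (f k)).Adj (f 0) u ↔ u = x ∨ u = f 1 := by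
      intro u
      by_cases hu : u = f k
      · rw [hu]
        simp [pushVertex_adj_right, htr, hfx k le_rfl, (hit 1 (by omega)).symm]
      · rw [pushVertex_adj_of_ne hrk hu, hout]
    have hr' := outDeg_eq_two hne hout'
    have hx' := hD.outDeg_push_of_in htx
    refine .of_push (f k) fun r' hr'' => ?_
    rw [hout'] at hr''
    rcases hr'' with rfl | rfl | rfl
    · exact doomed_of_irregular hconn hreg hD' hne hout' (Or.inr (Or.inl (by omega)))
    · exact doomed_of_adj hconn hreg hD' ((hout' _).2 (Or.inl rfl)) hr'.le (by omega)
    · by_cases h1 : outDeg (pushVertex D (f k)) (f 1) = 2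
      · refine ih (k - 2) (by omega) _ (fun i => f (i + 1)) hD' h1 ?_ ?_
        · intro i hi
          exact (pushVertex_adj_of_ne (hit _ (by omega)) (hit _ (by omega))).2 (hf _ (by omega))
        · have hlast := hf (k - 1) (by omega)
          have h2 : k - 1 + 1 = k := by omega
          have h3 : k - 2 + 1 = k - 1 := by omega
          rw [h2] at hlast
          have h4 := hD.outDeg_push_of_out hlast
          have h5 := hint (k - 1) (by omega)
          simp only [h3]
          omega
      · exact doomed_of_adj hconn hreg hD' ((hout' _).2 (Or.inr rfl)) hr'.le h1

end Walk

/-! ### Reaching an irregular vertex -/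

section Reach

variable {V : Type*} [Finite V] {G : SimpleGraph V} {D : Digraph V} {r : V}

/-- If every vertex that can be reached from `r` has out-degree two, then these vertices receive
as many arcs as they send, and send them only to each other; so they are the whole graph. -/
theorem outDeg_eq_two_of_reachable (hconn : G.Connected)
    (hreg : ∀ v, (G.neighborSet v).ncard = 4) (hD : IsOrientation D G)
    (h : ∀ v, Relation.ReflTransGen D.Adj r v → outDeg D v = 2) (v : V) : outDeg D v = 2 := by
  classical
  cases nonempty_fintype V
  let R : Finset V := Finset.univ.filter (Relation.ReflTransGen D.Adj r)
  have hR : ∀ {v}, v ∈ R ↔ Relation.ReflTransGen D.Adj r v := by simp [R]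
  let A : Finset (V × V) := Finset.univ.filter fun p => p.1 ∈ R ∧ D.Adj p.1 p.2
  let B : Finset (V × V) := Finset.univ.filter fun p => p.2 ∈ R ∧ D.Adj p.1 p.2
  have hAB : A ⊆ B := by
    intro p
    simp only [A, B, Finset.mem_filter, Finset.mem_univ, true_and, hR]
    exact fun hp => ⟨hp.1.tail hp.2, hp.2⟩
  have hA : A.card = R.card * 2 := by
    rw [Finset.card_eq_sum_card_fiberwise (f := Prod.fst) (t := R) fun p hp =>
      (Finset.mem_filter.1 hp).2.1]
    refine Finset.sum_const_nat fun v hv => ?_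
    rw [← h v (hR.1 hv), outDeg, Set.ncard_eq_toFinset_card']
    refine Finset.card_nbij' Prod.snd (fun u => (v, u)) ?_ ?_ ?_ ?_
    · rintro ⟨a, b⟩ hp
      simp only [A, Finset.coe_filter, Finset.mem_filter, Set.mem_ofPred_eq] at hp
      simpa [← hp.2] using hp.1.2.2
    · intro u hu
      simpa [A, hv] using hu
    · rintro ⟨a, b⟩ hp
      simp only [Finset.coe_filter, Set.mem_ofPred_eq] at hp
      simp [← hp.2]
    · intro u _
      rfl
  have hB : B.card = R.card * 2 := by
    rw [Finset.card_eq_sum_card_fiberwise (f := Prod.snd) (t := R) fun p hp =>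
      (Finset.mem_filter.1 hp).2.1]
    refine Finset.sum_const_nat fun v hv => ?_
    have hin : {u | D.Adj u v}.ncard = 2 := by
      have := hD.outDeg_add_inDeg hreg v
      have := h v (hR.1 hv)
      omega
    rw [← hin, Set.ncard_eq_toFinset_card']
    refine Finset.card_nbij' Prod.fst (fun u => (u, v)) ?_ ?_ ?_ ?_
    · rintro ⟨a, b⟩ hp
      simp only [B, Finset.coe_filter, Finset.mem_filter, Set.mem_ofPred_eq] at hp
      simpa [← hp.2] using hp.1.2.2
    · intro u hu
      simpa [B, hv] using hu
    · rintro ⟨a, b⟩ hp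
      simp only [Finset.coe_filter, Set.mem_ofPred_eq] at hp
      simp [← hp.2]
    · intro u _
      rfl
  have heq : A = B := Finset.eq_of_subset_of_card_le hAB (by rw [hA, hB])
  have hclosed : ∀ a b, G.Adj a b → a ∈ R → b ∈ R := by
    intro a b hab ha
    rcases (hD.adj_iff a b).1 hab with h1 | h1
    · exact hR.2 ((hR.1 ha).tail h1)
    · have : (b, a) ∈ A := by
        rw [heq]
        simp [B, ha, h1]
      simpa [A, h1] using this
  have hall : ∀ v, G.Reachable r v → v ∈ R := by
    rintro v ⟨p⟩
    have : ∀ {a b : V}, G.Walk a b → a ∈ R → b ∈ R := by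
      intro a b p
      induction p with
      | nil => exact id
      | cons hab _ ih => exact fun ha => ih (hclosed _ _ hab ha)
    exact this p (hR.2 .refl)
  exact h v (hR.1 (hall v (hconn r v)))

theorem exists_walk_of_reflTransGen {V : Type*} {D : Digraph V} {r v : V}
    (h : Relation.ReflTransGen D.Adj r v) :
    ∃ (k : ℕ) (f : ℕ → V), f 0 = r ∧ f k = v ∧ ∀ i < k, D.Adj (f i) (f (i + 1)) := by
  induction h using Relation.ReflTransGen.head_induction_on with
  | refl => exact ⟨0, fun _ => v, rfl, rfl, by simp⟩
  | @head a b hab _ ih =>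
    obtain ⟨k, f, h0, hk, hf⟩ := ih
    refine ⟨k + 1, fun i => Nat.casesOn i a f, rfl, hk, fun i hi => ?_⟩
    cases i with
    | zero => simpa [h0] using hab
    | succ i => exact hf i (by omega)

/-- The first forcing push takes an arc from the robber's vertex, so that not every vertex has
out-degree two; hence the robber can be led along a walk. -/
theorem doomed_of_outDeg_eq_two (hconn : G.Connected)
    (hreg : ∀ v, (G.neighborSet v).ncard = 4) (hD : IsOrientation D G)
    (hr : outDeg D r = 2) : Doomed D r := by
  obtain ⟨y, hy⟩ : {u | D.Adj r u}.Nonempty := by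
    rw [← Set.ncard_pos]
    exact two_pos.trans_eq hr.symm
  obtain ⟨x, hne, hout⟩ := exists_adj_iff_of_outDeg_eq_two hr hy
  have hrx : D.Adj r x := (hout x).2 (Or.inl rfl)
  have hr' := hD.outDeg_push_of_out hrx
  refine doomed_of_force hconn hD hne hout ?_
  by_cases hy2 : outDeg (pushVertex D x) y = 2
  · obtain ⟨v, hyv, hv⟩ : ∃ v, Relation.ReflTransGen (pushVertex D x).Adj y v ∧
        outDeg (pushVertex D x) v ≠ 2 := by
      by_contra! hall
      have := outDeg_eq_two_of_reachable hconn hreg (hD.push x) hall r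
      omega
    obtain ⟨k, f, rfl, rfl, hf⟩ := exists_walk_of_reflTransGen hyv
    exact walkDooms hconn hreg k _ f (hD.push x) hy2 hf hv
  · exact doomed_of_adj hconn hreg (hD.push x)
      ((pushVertex_adj_of_ne (hD.ne hrx) hne.symm).2 hy) (by omega) hy2

theorem doomed (hconn : G.Connected) (hreg : ∀ v, (G.neighborSet v).ncard = 4)
    (hD : IsOrientation D G) (r : V) : Doomed D r := by
  have le_two : ∀ {D : Digraph V} {r : V}, IsOrientation D G → outDeg D r ≤ 2 → Doomed D r := by
    intro D r hD h
    interval_cases h' : outDeg D r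
    · exact doomed_of_outDeg_eq_zero hconn hD h'
    · exact doomed_of_outDeg_eq_one hconn hD h'
    · exact doomed_of_outDeg_eq_two hconn hreg hD h'
  have hr := hD.outDeg_add_inDeg hreg r
  rcases Nat.lt_or_ge (outDeg D r) 3 with h | h
  · exact le_two hD (by omega)
  rcases h.eq_or_lt with h | h
  · obtain ⟨e, he⟩ : {u | D.Adj u r}.Nonempty := by
      rw [← Set.ncard_pos]
      omega
    refine doomed_of_force_back hconn hreg hD h.symm he ?_
    by_cases he2 : outDeg (pushVertex D r) e = 2
    · exact doomed_of_outDeg_eq_two hconn hreg (hD.push r) he2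
    · have := hD.outDeg_push_self hreg r
      exact doomed_of_adj hconn hreg (hD.push r) (pushVertex_adj_left.2 he) (by omega) he2
  · exact doomed_of_outDeg_eq_four hconn hreg hD (by omega)

end Reach

theorem mainTheorem4 {V : Type*} [Fintype V] (G : SimpleGraph V) [DecidableRel G.Adj]
    (hconn : G.Connected) (hreg : G.IsRegularOfDegree 4)
    (D : Digraph V) (hD : IsOrientation D G) :
    strongPushCopNumber D = 1 := by
  have hreg' : ∀ v, (G.neighborSet v).ncard = 4 := by
    intro v
    rw [← hreg.degree_eq v, Set.ncard_eq_toFinset_card']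
    rfl
  have := hconn.nonempty
  have hone : StrongPushCopsWin D 1 := strongPushCopsWin_one_of_catchable D
    (Classical.arbitrary V) fun r => doomed hconn hreg' hD r _
  have hzero := not_strongPushCopsWin_zero D
  have hmem : StrongPushCopsWin D (strongPushCopNumber D) :=
    Nat.sInf_mem (s := {k : ℕ | StrongPushCopsWin D k}) ⟨1, hone⟩
  have hle : strongPushCopNumber D ≤ 1 := Nat.sInf_le hone
  refine le_antisymm hle (Nat.one_le_iff_ne_zero.2 fun h => ?_)
  rw [h] at hmem
  exact hzero hmem
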